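/- Let $X$ be a (real) reflexive Banach space, let $K$ be a nonempty closed convex subset of $X$, and let $D\subseteq K$ be self segment-dense in $K$ with respect to the weak topology of $X$; that is, $D$ is weakly dense in $K$ and, for all $u,v\in D$, the set $[u,v]\cap D$ is weakly dense in the closed segment $[u,v]$. Let $F:K\times K\rightrightarrows\mathbb R$ be a set-valued map such that: (i) for every $y\in D$, the map $x\mapsto F(x,y)$ is weakly lower semicontinuous on $K$; (ii) for every $x\in K$, the map $y\mapsto F(x,y)$, defined on $K$, is weakly lower semicontinuous at every point of $K\setminus D$; (iii) for every $x\in K$, the map $y\mapsto F(x,y)$ is convex on $K$, i.e. $\sum_{i=1}^n\lambda_iF(x,y_i)\subseteq F\bigl(x,\sum_{i=1}^n\lambda_iy_i\bigr)$ (Minkowski sum) for all $n\ge 1$, $y_1,\dots,y_n\in K$ and $\lambda_1,\dots,\lambda_n\ge 0$ with $\sum_{i=1}^n\lambda_i=1$; (iv) for every $x\in K$, $F(x,x)\subseteq[0,\infty)$ and $0\in F(x,x)$; (v) there is $r>0$ such that for every $x\in K$ with $\|x\|>r$ there is $y_0\in K$ with $\|y_0\|<\|x\|$ and $F(x,y_0)\cap(-\infty,0]\ne\emptyset$.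 Here a set-valued map $T:K\rightrightarrows\mathbb R$ is weakly lower semicontinuous at $x\in K$ if for every open $N\subseteq\mathbb R$ with $T(x)\cap N\ne\emptyset$ there is a weak neighbourhood $M$ of $x$ such that $T(z)\cap N\neq\emptyset$ for all $z\in M\cap K$. Then there exists $x_0\in K$ such that $F(x_0,y)\ge 0$ for all $y\in K$, that is, $F(x_0,y)\subseteq[0,\infty)$ for all $y\in K$. -/

import Mathlib

/-- A normed space is reflexive if the canonical map into its bidual is surjective
(it is always an isometric embedding). -/
def IsReflexiveSpace (X : Type*) [NormedAddCommGroup X] [NormedSpace ℝ X] : Prop :=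
  Function.Surjective (NormedSpace.inclusionInDoubleDual ℝ X)

/-- `U` is self segment-dense in the convex set `V`: `U` is dense in `V`, and for all `x, y ∈ U`
the set `[x, y] ∩ U` is dense in `[x, y]`. -/
structure IsSelfSegmentDense {E : Type*} [AddCommGroup E] [Module ℝ E] [TopologicalSpace E]
    (U V : Set E) : Prop where
  convex : Convex ℝ V
  subset : U ⊆ V
  dense : V ⊆ closure U
  segment_dense : ∀ x ∈ U, ∀ y ∈ U, segment ℝ x y ⊆ closure (segment ℝ x y ∩ U)

/-- A subset of `X`, viewed as a subset of `X` endowed with its weak topology. -/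
def weakSet {X : Type*} [NormedAddCommGroup X] [NormedSpace ℝ X] (A : Set X) :
    Set (WeakSpace ℝ X) :=
  (toWeakSpace ℝ X) '' A

/-- The set-valued map `T`, regarded as a map on `K`, is weakly lower semicontinuous at `x`:
for every open `N` meeting `T x`, there is a weak neighbourhood `M` of `x` such that `N` meets
`T z` for every `z ∈ M ∩ K`. -/
def WeakLscWithinAt {X : Type*} [NormedAddCommGroup X] [NormedSpace ℝ X]
    (T : X → Set ℝ) (K : Set X) (x : X) : Prop :=
  LowerHemicontinuousWithinAt (fun z : WeakSpace ℝ X => T ((toWeakSpace ℝ X).symm z))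
    (weakSet K) (toWeakSpace ℝ X x)

open Pointwise in
/-- The set-valued map `T` is convex on `A` (not necessarily a convex set): whenever a convex
combination of points `x i` of `A` lies in `A`, the Minkowski sum `∑ i, l i • T (x i)` is
contained in `T (∑ i, l i • x i)`. -/
def SetValuedConvexOn {X : Type*} [AddCommGroup X] [Module ℝ X]
    (T : X → Set ℝ) (A : Set X) : Prop :=
  ∀ (n : ℕ) (x : Fin n → X) (l : Fin n → ℝ),
    (∀ i, x i ∈ A) → (∀ i, 0 ≤ l i) → ∑ i, l i = 1 → ∑ i, l i • x i ∈ A →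
      ∑ i, l i • T (x i) ⊆ T (∑ i, l i • x i)

/-! Cut `K` down to `B = K ∩ closedBall 0 R`, which is weakly compact by reflexivity. For `y ∈ D ∩
B` the sets `{x ∈ B | F x y ⊆ [0, ∞)}` are weakly closed by (i). Convexity in `y` and (iv) give them
the KKM property, so they share a point `x` (`exists_forall_subset_Ici_of_isCompact_weakSet`).

Self segment-density makes `D` norm dense in `K` (`IsSelfSegmentDense.subset_closure_of_weakSet`),
so (ii) extends nonnegativity of `F x` from `D ∩ B` to `B`. By (iv) or (v), `F x b` contains a
nonpositive number for some `b ∈ K` with `‖b‖ < R`. A negative value at any `y ∈ K` would then yield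
one inside the ball, near `b` on `[b, y]`.

The KKM lemma is derived from the absence of a C¹ retraction onto a sphere, proved by comparing
volumes. -/

/-! ### No C¹ retraction onto a sphere. -/

/-- If a contraction `k` vanishes outside a closed ball and `x ↦ x + k x` maps the ball into itself,
then `x ↦ x + k x` is a bijection of the ball. -/
theorem bijOn_closedBall_add_of_lipschitzWith {E : Type*} [NormedAddCommGroup E] [NormedSpace ℝ E]
    [CompleteSpace E] {R : ℝ} {k : E → E} {c : NNReal} (hc : c < 1) (hk : LipschitzWith c k)
    (hout : ∀ x ∉ Metric.closedBall (0 : E) R, k x = 0)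
    (hin : ∀ x ∈ Metric.closedBall (0 : E) R, x + k x ∈ Metric.closedBall (0 : E) R) :
    Set.BijOn (fun x => x + k x) (Metric.closedBall 0 R) (Metric.closedBall 0 R) := by
  have happ : ApproximatesLinearOn (fun x => x + k x)
      ((ContinuousLinearEquiv.refl ℝ E : E ≃L[ℝ] E) : E →L[ℝ] E) Set.univ c := by
    rw [ApproximatesLinearOn.approximatesLinearOn_iff_lipschitzOnWith, lipschitzOnWith_univ]
    convert hk using 1
    ext x
    simp
  have hc' : Subsingleton E ∨
      c < ‖((ContinuousLinearEquiv.refl ℝ E).symm : E →L[ℝ] E)‖₊⁻¹ := by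
    rcases subsingleton_or_nontrivial E with h | h
    · exact Or.inl h
    · right
      have : ‖((ContinuousLinearEquiv.refl ℝ E).symm : E →L[ℝ] E)‖₊ = 1 := by
        ext
        simp
      simpa [this] using hc
  let φ := happ.toHomeomorph _ hc'
  have hφ : ∀ x, φ x = x + k x := fun x => rfl
  refine ⟨fun x hx => hin x hx, fun x _ y _ hxy => φ.injective hxy, fun y hy => ?_⟩
  refine ⟨φ.symm y, ?_, φ.apply_symm_apply y⟩
  by_contra hx
  have h1 := hφ (φ.symm y)
  rw [hout _ hx, φ.apply_symm_apply, add_zero] at h1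
  exact hx (h1 ▸ hy)

/-- A segment leaving the ball crosses the sphere, where `h` vanishes, and the crossing point is no
farther from the inner endpoint than the outer one is. -/
theorem lipschitzWith_indicator_closedBall {E F : Type*} [NormedAddCommGroup E] [NormedSpace ℝ E]
    [NormedAddCommGroup F] {R : ℝ} {h : E → F} {L : NNReal}
    (hL : LipschitzOnWith L h (Metric.closedBall 0 R)) (h0 : ∀ x, ‖x‖ = R → h x = 0) :
    LipschitzWith L ((Metric.closedBall (0 : E) R).indicator h) := by
  have key : ∀ x y : E, x ∈ Metric.closedBall (0 : E) R → y ∉ Metric.closedBall (0 : E) R →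
      ‖h x‖ ≤ L * ‖x - y‖ := by
    intro x y hx hy
    have hx' : ‖x‖ ≤ R := by simpa using hx
    have hy' : R < ‖y‖ := by simpa using hy
    have hcont : ContinuousOn (fun t : ℝ => ‖AffineMap.lineMap x y t‖) (Set.Icc 0 1) := by
      have : Continuous (fun t : ℝ => AffineMap.lineMap x y t) := AffineMap.lineMap_continuous
      exact this.norm.continuousOn
    obtain ⟨t, ht, hte⟩ := intermediate_value_Icc (zero_le_one' ℝ) hcont
      (show R ∈ Set.Icc _ _ by simpa using ⟨hx', hy'.le⟩)
    have hz : AffineMap.lineMap x y t ∈ Metric.closedBall (0 : E) R := by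
      simpa using hte.le
    have h1 := hL.norm_sub_le hx hz
    rw [h0 _ hte, sub_zero] at h1
    refine h1.trans (mul_le_mul_of_nonneg_left ?_ L.2)
    rw [← dist_eq_norm, dist_left_lineMap, ← dist_eq_norm, Real.norm_of_nonneg ht.1]
    exact mul_le_of_le_one_left dist_nonneg ht.2
  refine LipschitzWith.of_dist_le_mul fun x y => ?_
  rw [dist_eq_norm, dist_eq_norm]
  by_cases hx : x ∈ Metric.closedBall (0 : E) R <;> by_cases hy : y ∈ Metric.closedBall (0 : E) R
  · simpa [Set.indicator_of_mem hx, Set.indicator_of_mem hy] using hL.norm_sub_le hx hy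
  · simpa [Set.indicator_of_mem hx, Set.indicator_of_notMem hy] using key x y hx hy
  · rw [Set.indicator_of_notMem hx, Set.indicator_of_mem hy, zero_sub, norm_neg, norm_sub_rev]
    exact key y x hy hx
  · rw [Set.indicator_of_notMem hx, Set.indicator_of_notMem hy]
    simpa using mul_nonneg L.2 (norm_nonneg (x - y))

open Polynomial in
theorem exists_polynomial_eval_eq_det_one_add_smul {E : Type*} [NormedAddCommGroup E]
    [NormedSpace ℝ E] [FiniteDimensional ℝ E] (A : E →L[ℝ] E) :
    ∃ p : ℝ[X], p.degree < ((Module.finrank ℝ E + 1 : ℕ) : WithBot ℕ) ∧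
      ∀ t : ℝ, p.eval t = (ContinuousLinearMap.id ℝ E + t • A).det := by
  let b := Module.finBasis ℝ E
  let M := LinearMap.toMatrix b b (A : E →ₗ[ℝ] E)
  refine ⟨((X : ℝ[X]) • M.map C + (1 : Matrix _ _ ℝ).map C).det, ?_, fun t => ?_⟩
  · refine lt_of_le_of_lt degree_le_natDegree ?_
    refine WithBot.coe_lt_coe.2 (Nat.lt_succ_of_le ?_)
    simpa using natDegree_det_X_add_C_le M 1
  · rw [eval_det]
    have : (ContinuousLinearMap.id ℝ E + t • A).det =
        LinearMap.det (LinearMap.id + t • (A : E →ₗ[ℝ] E)) := rfl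
    rw [this, ← LinearMap.det_toMatrix b]
    congr 1
    simp only [map_add, LinearMap.toMatrix_id, map_smul]
    ext i j
    by_cases hij : i = j <;> simp [M, hij] <;> ring

open MeasureTheory Polynomial in
/-- There is no continuously differentiable retraction onto a sphere of positive radius. -/
theorem not_contDiff_retraction_sphere {E : Type*} [NormedAddCommGroup E]
    [InnerProductSpace ℝ E] [FiniteDimensional ℝ E] {R : ℝ} (hR : 0 < R) {g : E → E}
    (hg : ContDiff ℝ 1 g) (hnorm : ∀ x, ‖g x‖ = R) (hid : ∀ x, ‖x‖ = R → g x = x) : False := by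
  let _ : MeasurableSpace E := borel E
  have : BorelSpace E := ⟨rfl⟩
  set B := Metric.closedBall (0 : E) R with hB
  have hBc : IsCompact B := isCompact_closedBall 0 R
  let h : E → E := fun x => g x - x
  have hh : ContDiff ℝ 1 h := hg.sub contDiff_id
  let A : E → E →L[ℝ] E := fderiv ℝ h
  have hA : Continuous A := hh.continuous_fderiv one_ne_zero
  have hAd : ∀ x, HasFDerivAt h (A x) x := fun x =>
    (hh.differentiable one_ne_zero x).hasFDerivAt
  obtain ⟨L, hLpos, hL⟩ : ∃ L : NNReal, 0 < L ∧ ∀ x ∈ B, ‖A x‖ ≤ L := by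
    obtain ⟨C, hC⟩ := hBc.exists_bound_of_continuousOn hA.continuousOn
    exact ⟨Real.toNNReal (max C 1), by simp, fun x hx =>
      (hC x hx).trans ((le_max_left _ _).trans (Real.le_coe_toNNReal _))⟩
  have hlip : LipschitzOnWith L h B :=
    (convex_closedBall 0 R).lipschitzOnWith_of_nnnorm_hasFDerivWithin_le
      (fun x _ => (hAd x).hasFDerivWithinAt) (fun x hx => hL x hx)
  have hind := lipschitzWith_indicator_closedBall hlip
    (fun x hx => by simp [h, hid x hx])
  obtain ⟨ε, hε, hdet⟩ : ∃ ε > 0, ∀ T : E →L[ℝ] E, ‖T‖ < ε →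
      0 < (ContinuousLinearMap.id ℝ E + T).det := by
    have hc : Continuous fun T : E →L[ℝ] E => (ContinuousLinearMap.id ℝ E + T).det :=
      ContinuousLinearMap.continuous_det.comp (continuous_const.add continuous_id)
    have h0 : (0 : E →L[ℝ] E) ∈ {T : E →L[ℝ] E | 0 < (ContinuousLinearMap.id ℝ E + T).det} := by
      simp [ContinuousLinearMap.det]
    obtain ⟨ε, hε, hs⟩ := Metric.isOpen_iff.1 (isOpen_lt continuous_const hc) 0 h0
    exact ⟨ε, hε, fun T hT => hs (by simpa using hT)⟩
  -- For `t ≤ δ` the three bounds make `x + t • h x = (1 - t) • x + t • g x` a convex combination,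
  -- `t • h` a contraction on `B`, and the Jacobian positive.
  obtain ⟨δ, hδ, hδ1, hδL, hδε⟩ : ∃ δ : ℝ, 0 < δ ∧ δ ≤ 1 ∧ δ * L < 1 ∧ δ * L < ε := by
    have hLp : (0 : ℝ) < L := hLpos
    refine ⟨min 1 (min 1 ε / (2 * L)), by positivity, min_le_left _ _, ?_, ?_⟩
    all_goals
      have h1 : min 1 (min 1 ε / (2 * L)) * (L : ℝ) ≤ min 1 ε / (2 * L) * L :=
        mul_le_mul_of_nonneg_right (min_le_right _ _) hLp.le
      have h2 : min 1 ε / (2 * L) * L = min 1 ε / 2 := by field_simp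
      have h3 := min_le_left 1 ε
      have h4 := min_le_right 1 ε
      linarith
  let J : ℝ → E → ℝ := fun t x => (ContinuousLinearMap.id ℝ E + t • A x).det
  have hJc : ∀ t, Continuous (J t) := fun t =>
    ContinuousLinearMap.continuous_det.comp (continuous_const.add (hA.const_smul t))
  have hJi : ∀ t, IntegrableOn (J t) B volume := fun t =>
    (hJc t).continuousOn.integrableOn_compact hBc
  have hsmall : ∀ t ∈ Set.Icc 0 δ, ∫ x in B, J t x = volume.real B := by
    intro t ht
    have hbij : Set.BijOn (fun x => x + t • h x) B B := by
      have hc : Real.toNNReal t * L < 1 := by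
        rw [← NNReal.coe_lt_coe]
        push_cast
        rw [Real.coe_toNNReal _ ht.1]
        exact (mul_le_mul_of_nonneg_right ht.2 L.2).trans_lt hδL
      have hk : LipschitzWith (Real.toNNReal t * L) (fun x => t • B.indicator h x) := by
        refine LipschitzWith.of_dist_le_mul fun x y => ?_
        rw [dist_smul₀, Real.norm_of_nonneg ht.1]
        push_cast
        rw [Real.coe_toNNReal _ ht.1, mul_assoc]
        exact mul_le_mul_of_nonneg_left (hind.dist_le_mul x y) ht.1
      refine (bijOn_closedBall_add_of_lipschitzWith hc hk
        (fun x hx => by simp [B, Set.indicator_of_notMem hx]) (fun x hx => ?_)).congr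
        (fun x hx => by simp only [B, Set.indicator_of_mem hx])
      simp only [B, Set.indicator_of_mem hx]
      have hcomb : x + t • h x = (1 - t) • x + t • g x := by
        simp only [h]; module
      rw [hcomb]
      exact convex_closedBall 0 R hx (by simp [hnorm]) (by linarith [ht.2]) ht.1 (by ring)
    have hder : ∀ x ∈ B, HasFDerivWithinAt (fun x => x + t • h x)
        (ContinuousLinearMap.id ℝ E + t • A x) B x := fun x _ =>
      ((hasFDerivAt_id x).add ((hAd x).const_smul t)).hasFDerivWithinAt
    have hcv := integral_image_eq_integral_abs_det_fderiv_smul volume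
      hBc.measurableSet hder hbij.injOn (fun _ => (1 : ℝ))
    rw [hbij.image_eq] at hcv
    have h1 : ∫ x in B, (1 : ℝ) = volume.real B := by simp
    rw [← h1, hcv]
    refine setIntegral_congr_fun hBc.measurableSet fun x hx => ?_
    have hpos : 0 < J t x := hdet _ (by
      rw [norm_smul, Real.norm_of_nonneg ht.1]
      exact (mul_le_mul ht.2 (hL x hx) (norm_nonneg _) hδ.le).trans_lt hδε)
    simp only [smul_eq_mul, mul_one]
    exact (abs_of_pos hpos).symm
  -- Lagrange interpolation at nodes in `[0, δ]` expresses the integral at `1`.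
  set N := Module.finrank ℝ E + 1 with hN
  let v : ℕ → ℝ := fun i => δ / (i + 1)
  have hv : Set.InjOn v (Finset.range N) := by
    intro i _ j _ hij
    have h1 : (0 : ℝ) < i + 1 := by positivity
    have h2 : (0 : ℝ) < j + 1 := by positivity
    simp only [v] at hij
    rw [div_eq_div_iff h1.ne' h2.ne'] at hij
    have := mul_left_cancel₀ hδ.ne' hij
    exact_mod_cast (add_right_cancel this).symm
  have hvmem : ∀ i, v i ∈ Set.Icc 0 δ := fun i =>
    ⟨by positivity, div_le_self hδ.le (by linarith [(Nat.cast_nonneg i : (0 : ℝ) ≤ i)])⟩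
  let w : ℕ → ℝ := fun i => (Lagrange.basis (Finset.range N) v i).eval 1
  have hw : ∑ i ∈ Finset.range N, w i = 1 := by
    have := congrArg (Polynomial.eval (1 : ℝ)) (Lagrange.sum_basis hv ⟨0, by simp [hN]⟩)
    simpa [eval_finsetSum] using this
  have hJ1 : ∀ x, J 1 x = ∑ i ∈ Finset.range N, J (v i) x * w i := by
    intro x
    obtain ⟨p, hp, hpe⟩ := exists_polynomial_eval_eq_det_one_add_smul (A x)
    have hint := Lagrange.eq_interpolate (f := p) hv (by simpa [hN] using hp)
    have := congrArg (Polynomial.eval (1 : ℝ)) hint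
    simpa [Lagrange.interpolate_apply, eval_finsetSum, hpe, J, w] using this
  -- `‖g‖²` is constant, so every value of the derivative of `g` at `x` is orthogonal to `g x ≠ 0`;
  -- that derivative cannot be surjective.
  have hzero : ∀ x, J 1 x = 0 := by
    intro x
    by_contra hne
    have hgd : HasFDerivAt g (ContinuousLinearMap.id ℝ E + (1 : ℝ) • A x) x := by
      have := (hasFDerivAt_id (𝕜 := ℝ) x).add ((hAd x).const_smul (1 : ℝ))
      refine this.congr_of_eventuallyEq (Filter.Eventually.of_forall fun y => ?_)
      simp [h]
    have hsq : HasFDerivAt (fun y => ‖g y‖ ^ 2) (0 : E →L[ℝ] ℝ) x := by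
      simp only [hnorm]
      exact hasFDerivAt_const _ _
    have heq := hsq.unique hgd.norm_sq
    have hsurj : Function.Surjective (ContinuousLinearMap.id ℝ E + (1 : ℝ) • A x) := by
      have hu : IsUnit (LinearMap.det
          ((ContinuousLinearMap.id ℝ E + (1 : ℝ) • A x : E →L[ℝ] E) : E →ₗ[ℝ] E)) :=
        isUnit_iff_ne_zero.2 hne
      exact (LinearEquiv.ofIsUnitDet (v := Module.finBasis ℝ E) (v' := Module.finBasis ℝ E)
        (f := ((ContinuousLinearMap.id ℝ E + (1 : ℝ) • A x : E →L[ℝ] E) : E →ₗ[ℝ] E))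
        (by rwa [LinearMap.det_toMatrix])).surjective
    obtain ⟨u, hu⟩ := hsurj (g x)
    have h2 := congrArg (fun T : E →L[ℝ] ℝ => T u) heq
    generalize ContinuousLinearMap.id ℝ E + (1 : ℝ) • A x = T at hu h2
    simp [hu, hnorm] at h2
    exact hR.ne' h2
  have hvol : volume.real B = 0 := by
    have h1 : ∫ x in B, J 1 x = volume.real B := by
      simp_rw [hJ1]
      rw [integral_finsetSum _ fun i _ => (hJi (v i)).mul_const _]
      simp_rw [integral_mul_const]
      rw [Finset.sum_congr rfl fun i _ => by rw [hsmall _ (hvmem i)], ← Finset.mul_sum, hw,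
        mul_one]
    rw [← h1]
    simp [hzero]
  have : 0 < volume.real B :=
    ENNReal.toReal_pos (Metric.measure_closedBall_pos volume 0 hR).ne' hBc.measure_lt_top.ne
  linarith

/-- A continuously differentiable self-map which is the identity outside a ball has a zero. -/
theorem exists_eq_zero_of_contDiff_of_eq_id {E : Type*} [NormedAddCommGroup E]
    [InnerProductSpace ℝ E] [FiniteDimensional ℝ E] {R : ℝ} {f : E → E}
    (hf : ContDiff ℝ 1 f) (hid : ∀ x, R ≤ ‖x‖ → f x = x) : ∃ x, f x = 0 := by
  by_contra! hne
  have hR : 0 < max R 1 := by positivity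
  refine not_contDiff_retraction_sphere hR (g := fun x => (max R 1 / ‖f x‖) • f x) ?_ ?_ ?_
  · exact (contDiff_const.div (hf.norm ℝ hne) fun x => norm_ne_zero_iff.2 (hne x)).smul hf
  · intro x
    have := norm_pos_iff.2 (hne x)
    rw [norm_smul, Real.norm_of_nonneg (by positivity)]
    field_simp
  · intro x hx
    simp only [hid x (hx ▸ le_max_left _ _), hx]
    rw [div_self hR.ne', one_smul]

/-! ### The KKM lemma. -/

/-- A retraction of the coordinate space onto the standard simplex. -/
noncomputable def simplexRetraction {ι : Type*} [Fintype ι] (x : ι → ℝ) (i : ι) : ℝ :=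
  (max (x i) 0 + max (1 - ∑ j, max (x j) 0) 0 / Fintype.card ι) / max (∑ j, max (x j) 0) 1

theorem continuous_simplexRetraction {ι : Type*} [Fintype ι] :
    Continuous (simplexRetraction : (ι → ℝ) → ι → ℝ) := by
  refine continuous_pi fun i => ?_
  unfold simplexRetraction
  refine Continuous.div (by fun_prop) (by fun_prop) fun x => ?_
  positivity

theorem simplexRetraction_mem {ι : Type*} [Fintype ι] [Nonempty ι] (x : ι → ℝ) :
    simplexRetraction x ∈ stdSimplex ℝ ι := by
  refine ⟨fun i => by unfold simplexRetraction; positivity, ?_⟩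
  unfold simplexRetraction
  have hc : (Fintype.card ι : ℝ) ≠ 0 := by simp
  rw [← Finset.sum_div, Finset.sum_add_distrib, Finset.sum_const, Finset.card_univ, nsmul_eq_mul,
    mul_div_cancel₀ _ hc, div_eq_one_iff_eq (by positivity)]
  rcases le_total (∑ j, max (x j) 0) 1 with h | h
  · rw [max_eq_left (by linarith), max_eq_right h]; ring
  · rw [max_eq_right (by linarith), max_eq_left h]; ring

theorem simplexRetraction_eq_self {ι : Type*} [Fintype ι] {x : ι → ℝ}
    (hx : x ∈ stdSimplex ℝ ι) : simplexRetraction x = x := by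
  funext i
  have h : ∀ j, max (x j) 0 = x j := fun j => max_eq_left (hx.1 j)
  simp [simplexRetraction, h, hx.2]

open scoped Manifold in
/-- The Knaster–Kuratowski–Mazurkiewicz lemma. -/
theorem exists_mem_stdSimplex_forall_mem {ι : Type*} [Fintype ι] [Nonempty ι]
    (C : ι → Set (ι → ℝ)) (hC : ∀ i, IsClosed (C i))
    (hcov : ∀ x ∈ stdSimplex ℝ ι, ∃ i, 0 < x i ∧ x ∈ C i) :
    ∃ x ∈ stdSimplex ℝ ι, ∀ i, x ∈ C i := by
  by_contra! hne
  let E := EuclideanSpace ℝ ι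
  let r : E → ι → ℝ := fun x => simplexRetraction x.ofLp
  have hr : Continuous r := continuous_simplexRetraction.comp (PiLp.continuous_ofLp 2 _)
  let V : ι → Set E := fun i => r ⁻¹' (C i)ᶜ
  have hV : ∀ i, IsOpen (V i) := fun i => (hC i).isOpen_compl.preimage hr
  have hVc : (Set.univ : Set E) ⊆ ⋃ i, V i := fun x _ => by
    obtain ⟨i, hi⟩ := hne (r x) (simplexRetraction_mem _)
    exact Set.mem_iUnion.2 ⟨i, hi⟩
  -- If the `C i` had no common point in the simplex, their complements would give a smooth
  -- partition of unity. A fixed point `x` of `s = (φ i)` lies in the simplex, and `0 < x i` forces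
  -- `x ∉ C i`, against the covering.
  obtain ⟨φ, hφ⟩ := SmoothPartitionOfUnity.exists_isSubordinate 𝓘(ℝ, E) isClosed_univ V hV hVc
  have hsum : ∀ x, ∑ i, φ i x = 1 := fun x => by
    rw [← finsum_eq_sum_of_fintype]
    exact φ.sum_eq_one (Set.mem_univ x)
  let s : E → E := fun x => WithLp.toLp 2 fun i => φ i x
  have hs : ContDiff ℝ 1 s := by
    rw [contDiff_euclidean]
    intro i
    exact (φ i).contMDiff.contDiff.of_le (by exact_mod_cast le_top)
  have hs1 : ∀ x, ‖s x‖ ≤ 1 := fun x => by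
    rw [EuclideanSpace.norm_eq, Real.sqrt_le_iff, one_pow]
    refine ⟨zero_le_one, ?_⟩
    rw [← hsum x]
    refine Finset.sum_le_sum fun i _ => ?_
    have h0 := φ.nonneg i x
    have h1 := φ.le_one i x
    simp only [s, Real.norm_of_nonneg h0]
    nlinarith
  -- The cutoff makes `x - χ x • s x` the identity for `‖x‖ ≥ 2`; its zeros have norm at most 1,
  -- where `χ = 1`.
  let χ : ContDiffBump (0 : E) := ⟨1, 2, one_pos, one_lt_two⟩
  obtain ⟨x, hx⟩ := exists_eq_zero_of_contDiff_of_eq_id (R := 2) (f := fun x => x - χ x • s x)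
    (contDiff_id.sub (χ.contDiff.smul hs)) (fun x hx => by
      simp [χ.zero_of_le_dist (x := x) (by simpa [χ] using hx)])
  have hx : x = χ x • s x := sub_eq_zero.1 hx
  have hx1 : ‖x‖ ≤ 1 := by
    rw [hx, norm_smul, Real.norm_of_nonneg χ.nonneg]
    exact mul_le_one₀ χ.le_one (norm_nonneg _) (hs1 x)
  rw [χ.one_of_mem_closedBall (by simpa [χ] using hx1), one_smul] at hx
  have hxi : ∀ i, x.ofLp i = φ i x := fun i => congrArg (fun y : E => y.ofLp i) hx
  have hxs : x.ofLp ∈ stdSimplex ℝ ι :=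
    ⟨fun i => hxi i ▸ φ.nonneg i x, by simp_rw [hxi, hsum]⟩
  obtain ⟨i, hi, hxC⟩ := hcov _ hxs
  have hxV : x ∈ V i := hφ i (subset_tsupport _ (by
    rw [Function.mem_support, ← hxi]; exact hi.ne'))
  have : r x = x.ofLp := simplexRetraction_eq_self hxs
  exact hxV (this ▸ hxC)

/-! ### Set-valued convexity, weak topology and density. -/

open Pointwise in
theorem SetValuedConvexOn.sum_mem {X : Type*} [AddCommGroup X] [Module ℝ X] {T : X → Set ℝ}
    {A : Set X} (hT : SetValuedConvexOn T A) {ι : Type*} (s : Finset ι) {p : ι → X} {l u : ι → ℝ}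
    (hp : ∀ i ∈ s, p i ∈ A) (hl : ∀ i ∈ s, 0 ≤ l i) (hl1 : ∑ i ∈ s, l i = 1)
    (hA : ∑ i ∈ s, l i • p i ∈ A) (hu : ∀ i ∈ s, u i ∈ T (p i)) :
    ∑ i ∈ s, l i * u i ∈ T (∑ i ∈ s, l i • p i) := by
  let e := s.equivFin.symm
  have key : ∀ f : ι → ℝ, ∑ k, f (e k) = ∑ i ∈ s, f i := fun f => by
    rw [Equiv.sum_comp e fun i : s => f i, Finset.sum_coe_sort]
  have keyX : ∑ k, l (e k) • p (e k) = ∑ i ∈ s, l i • p i := by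
    rw [Equiv.sum_comp e fun i : s => l i • p i, Finset.sum_coe_sort s fun i => l i • p i]
  have h := hT s.card (fun k => p (e k)) (fun k => l (e k)) (fun k => hp _ (e k).2)
    (fun k => hl _ (e k).2) (by rw [key l, hl1]) (by rwa [keyX])
  rw [keyX] at h
  refine h ?_
  rw [← key fun i => l i * u i]
  exact Set.finsetSum_mem_finsetSum _ _ _ fun k _ =>
    Set.smul_mem_smul_set (hu _ (e k).2)

theorem SetValuedConvexOn.add_mem {X : Type*} [AddCommGroup X] [Module ℝ X] {T : X → Set ℝ}
    {A : Set X} (hA : Convex ℝ A) (hT : SetValuedConvexOn T A) {x y : X} (hx : x ∈ A) (hy : y ∈ A)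
    {a b u v : ℝ} (ha : 0 ≤ a) (hb : 0 ≤ b) (hab : a + b = 1) (hu : u ∈ T x) (hv : v ∈ T y) :
    a * u + b * v ∈ T (a • x + b • y) := by
  have h := hT.sum_mem Finset.univ (p := ![x, y]) (l := ![a, b]) (u := ![u, v])
    (by simp [Fin.forall_fin_two, hx, hy]) (by simp [Fin.forall_fin_two, ha, hb])
    (by simpa using hab) (by simpa using hA hx hy ha hb hab)
    (by simp [Fin.forall_fin_two, hu, hv])
  simpa using h

theorem isClosed_weakSet {X : Type*} [NormedAddCommGroup X] [NormedSpace ℝ X] {A : Set X}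
    (hA : Convex ℝ A) (hAc : IsClosed A) : IsClosed (weakSet A) := by
  have h := hA.toWeakSpace_closure ℝ
  rw [hAc.closure_eq] at h
  exact isClosed_of_closure_subset h.ge

theorem isCompact_weakSet {X : Type*} [NormedAddCommGroup X] [NormedSpace ℝ X]
    (hX : IsReflexiveSpace X) {A : Set X} (hA : Convex ℝ A) (hAc : IsClosed A)
    (hAb : Bornology.IsBounded A) : IsCompact (weakSet A) := by
  rw [← (isClosed_weakSet hA hAc).closure_eq]
  refine NormedSpace.isCompact_closure_of_isBounded ℝ X _ ?_ fun z _ => ?_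
  · rwa [weakSet, Set.preimage_image_eq _ (toWeakSpace ℝ X).injective]
  · obtain ⟨x, hx⟩ := hX z.toStrongDual
    exact ⟨toWeakSpace ℝ X x, DFunLike.ext _ _ fun f =>
      congrArg (fun g : StrongDual ℝ (StrongDual ℝ X) => g f) hx⟩

theorem WeakLscWithinAt.mono {X : Type*} [NormedAddCommGroup X] [NormedSpace ℝ X]
    {T : X → Set ℝ} {A B : Set X} {x : X} (h : WeakLscWithinAt T A x) (hBA : B ⊆ A) :
    WeakLscWithinAt T B x := by
  unfold WeakLscWithinAt at h ⊢
  exact h.mono (Set.image_mono hBA)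

/-- The points where a weakly lower semicontinuous set-valued map takes values in a closed set
form a weakly closed set. -/
theorem isClosed_weakSet_sep {X : Type*} [NormedAddCommGroup X] [NormedSpace ℝ X]
    {T : X → Set ℝ} {A : Set X} (hA : IsClosed (weakSet A)) {t : Set ℝ} (ht : IsClosed t)
    (h : ∀ x ∈ A, WeakLscWithinAt T A x) : IsClosed (weakSet {x ∈ A | T x ⊆ t}) := by
  have hsub : weakSet {x ∈ A | T x ⊆ t} ⊆ weakSet A := Set.image_mono (Set.sep_subset _ _)
  refine isClosed_of_closure_subset fun z hz => ?_
  obtain ⟨x, hx, rfl⟩ := closure_minimal hsub hA hz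
  refine ⟨x, ⟨hx, ?_⟩, rfl⟩
  have hxT := h x hx
  unfold WeakLscWithinAt at hxT
  refine hxT.frequently t ht ?_
  rw [frequently_nhdsWithin_iff]
  refine (mem_closure_iff_frequently.1 hz).mono ?_
  rintro _ ⟨y, hy, rfl⟩
  exact ⟨by simpa using hy.2, Set.mem_image_of_mem _ hy.1⟩

/-- A weakly lower semicontinuous set-valued map taking values in a closed set on a norm dense
subset does so everywhere. -/
theorem WeakLscWithinAt.subset_of_mem_closure {X : Type*} [NormedAddCommGroup X]
    [NormedSpace ℝ X] {T : X → Set ℝ} {A S : Set X} {x : X} (h : WeakLscWithinAt T A x)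
    {t : Set ℝ} (ht : IsClosed t) (hSA : S ⊆ A) (hx : x ∈ closure S) (hS : ∀ y ∈ S, T y ⊆ t) :
    T x ⊆ t := by
  unfold WeakLscWithinAt at h
  refine h.frequently t ht ?_
  rw [frequently_nhdsWithin_iff]
  have hz : toWeakSpace ℝ X x ∈ closure (toWeakSpace ℝ X '' S) :=
    image_closure_subset_closure_image (toWeakSpaceCLM ℝ X).continuous ⟨x, hx, rfl⟩
  refine (mem_closure_iff_frequently.1 hz).mono ?_
  rintro _ ⟨y, hy, rfl⟩
  exact ⟨by simpa using hS y hy, Set.mem_image_of_mem _ (hSA hy)⟩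

/-- In a segment, weak density implies norm density. -/
theorem segment_subset_closure_of_weakSet {X : Type*} [NormedAddCommGroup X] [NormedSpace ℝ X]
    {D : Set X} {u v : X} (hu : u ∈ D)
    (h : weakSet (segment ℝ u v) ⊆ closure (weakSet (segment ℝ u v ∩ D))) :
    segment ℝ u v ⊆ closure D := by
  rcases eq_or_ne u v with rfl | huv
  · simpa using subset_closure hu
  -- A norming functional of `v - u` is isometric on the segment, so weak closeness there is norm
  -- closeness.
  obtain ⟨f, -, hf⟩ := exists_dual_vector ℝ (v - u) (norm_ne_zero_iff.2 (sub_ne_zero.2 huv.symm))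
  have hc : 0 < ‖v - u‖ := norm_pos_iff.2 (sub_ne_zero.2 huv.symm)
  have hf : f (v - u) = ‖v - u‖ := by simpa using hf
  have hfc : Continuous fun z : WeakSpace ℝ X => f ((toWeakSpace ℝ X).symm z) :=
    WeakBilin.eval_continuous (topDualPairing ℝ X).flip f
  have hdist : ∀ a ∈ segment ℝ u v, ∀ b ∈ segment ℝ u v, dist a b = |f a - f b| := by
    rw [segment_eq_image']
    rintro _ ⟨a, -, rfl⟩ _ ⟨b, -, rfl⟩
    have h1 : u + a • (v - u) - (u + b • (v - u)) = (a - b) • (v - u) := by module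
    rw [dist_eq_norm, h1, ← map_sub, h1, map_smul, hf, norm_smul, smul_eq_mul, abs_mul,
      abs_of_pos hc, Real.norm_eq_abs]
  intro z hz
  rw [Metric.mem_closure_iff]
  intro ε hε
  have hzc := h (Set.mem_image_of_mem _ hz)
  obtain ⟨_, hw, ⟨w, hwD, rfl⟩⟩ := mem_closure_iff.1 hzc
    {y | |f z - f ((toWeakSpace ℝ X).symm y)| < ε}
    (isOpen_lt (continuous_const.sub hfc).abs continuous_const) (by simpa using hε)
  exact ⟨w, hwD.2, by rw [hdist z hz w hwD.1]; simpa using hw⟩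

/-- A subset which is self segment-dense for the weak topology is dense for the norm. -/
theorem IsSelfSegmentDense.subset_closure_of_weakSet {X : Type*} [NormedAddCommGroup X]
    [NormedSpace ℝ X] {K D : Set X} (h : IsSelfSegmentDense (weakSet D) (weakSet K)) :
    K ⊆ closure D := by
  have hseg : ∀ u ∈ D, ∀ v ∈ D, segment ℝ u v ⊆ closure D := by
    intro u hu v hv
    refine segment_subset_closure_of_weakSet hu ?_
    have h1 := h.segment_dense _ (Set.mem_image_of_mem _ hu) _ (Set.mem_image_of_mem _ hv)
    have h2 : segment ℝ (toWeakSpace ℝ X u) (toWeakSpace ℝ X v) = weakSet (segment ℝ u v) :=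
      (image_segment ℝ (toWeakSpace ℝ X).toLinearMap.toAffineMap u v).symm
    rw [h2, weakSet, weakSet, ← Set.image_inter (toWeakSpace ℝ X).injective] at h1
    exact h1
  -- Convexity makes the norm closure weakly closed, so it contains the weak closure of `D`. It is
  -- proved by passing to the limit in one endpoint at a time.
  have hconv : Convex ℝ (closure D) := by
    intro x hx y hy a b ha hb hab
    refine closure_minimal (s := D) (t := {x | a • x + b • y ∈ closure D}) (fun u hu => ?_)
      (isClosed_closure.preimage (by fun_prop)) hx
    exact closure_minimal (s := D) (t := {y | a • u + b • y ∈ closure D})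
      (fun v hv => hseg u hu v hv ⟨a, b, ha, hb, hab, rfl⟩)
      (isClosed_closure.preimage (by fun_prop)) hy
  intro x hx
  have h1 : toWeakSpace ℝ X x ∈ weakSet (closure D) :=
    closure_minimal (Set.image_mono subset_closure) (isClosed_weakSet hconv isClosed_closure)
      (h.dense (Set.mem_image_of_mem _ hx))
  exact (toWeakSpace ℝ X).injective.mem_set_image.1 h1

/-! ### Ky Fan's inequality and the passage from the ball to `K`. -/

/-- A set-valued form of Ky Fan's inequality on weakly compact convex sets. -/
theorem exists_forall_subset_Ici_of_isCompact_weakSet {X : Type*} [NormedAddCommGroup X]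
    [NormedSpace ℝ X] {B Y : Set X} (hBne : B.Nonempty) (hB : Convex ℝ B)
    (hBc : IsCompact (weakSet B)) (hBcl : IsClosed (weakSet B)) (hYB : Y ⊆ B) {F : X → X → Set ℝ}
    (hlsc : ∀ y ∈ Y, ∀ x ∈ B, WeakLscWithinAt (fun z => F z y) B x)
    (hconv : ∀ x ∈ B, SetValuedConvexOn (F x) B) (hdiag : ∀ x ∈ B, F x x ⊆ Set.Ici 0) :
    ∃ x ∈ B, ∀ y ∈ Y, F x y ⊆ Set.Ici 0 := by
  let G : Y → Set X := fun y => {x ∈ B | F x y ⊆ Set.Ici 0}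
  have hG : ∀ y, IsClosed (weakSet (G y)) := fun y =>
    isClosed_weakSet_sep hBcl isClosed_Ici (hlsc y y.2)
  suffices hfin : ∀ u : Finset Y, (weakSet B ∩ ⋂ y ∈ u, weakSet (G y)).Nonempty by
    obtain ⟨_, ⟨x, hx, rfl⟩, hxG⟩ := hBc.inter_iInter_nonempty _ hG hfin
    refine ⟨x, hx, fun y hy => ?_⟩
    exact ((toWeakSpace ℝ X).injective.mem_set_image.1 (Set.mem_iInter.1 hxG ⟨y, hy⟩)).2
  intro u
  rcases u.eq_empty_or_nonempty with rfl | hu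
  · simpa [weakSet] using hBne
  have : Nonempty u := hu.to_subtype
  let c : (u → ℝ) → X := fun l => ∑ i, l i • ((i : Y) : X)
  have hc : Continuous fun l => toWeakSpace ℝ X (c l) :=
    (toWeakSpaceCLM ℝ X).continuous.comp
      (continuous_finsetSum _ fun i _ => (continuous_apply i).smul continuous_const)
  have hcB : ∀ l ∈ stdSimplex ℝ u, c l ∈ B := fun l hl =>
    hB.sum_mem (fun i _ => hl.1 i) hl.2 fun i _ => hYB (i : Y).2
  obtain ⟨l, hl, hlC⟩ := exists_mem_stdSimplex_forall_mem
    (fun i : u => (fun l => toWeakSpace ℝ X (c l)) ⁻¹' weakSet (G i))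
    (fun i => (hG i).preimage hc) (fun l hl => by
      -- Otherwise each `F (c l) i` with `0 < l i` has a negative element; their convex combination
      -- is a negative element of `F (c l) (c l)`.
      by_contra! hno
      let s := Finset.univ.filter fun i : u => 0 < l i
      have hs0 : ∀ i ∉ s, l i = 0 := fun i hi =>
        le_antisymm (not_lt.1 fun h => hi (by simpa [s] using h)) (hl.1 i)
      have hs1 : ∑ i ∈ s, l i = 1 := by
        rw [← hl.2]
        exact Finset.sum_subset (Finset.subset_univ _) fun i _ hi => hs0 i hi
      have hsc : ∑ i ∈ s, l i • ((i : Y) : X) = c l :=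
        Finset.sum_subset (Finset.subset_univ _) fun i _ hi => by rw [hs0 i hi, zero_smul]
      have hneg : ∀ i, ∃ v, i ∈ s → v ∈ F (c l) (i : Y) ∧ v < 0 := by
        intro i
        by_cases hi : i ∈ s
        · have h1 : ¬ F (c l) (i : Y) ⊆ Set.Ici 0 := fun h =>
            hno i (by simpa [s] using hi) (Set.mem_image_of_mem _ ⟨hcB l hl, h⟩)
          obtain ⟨v, hv, hv0⟩ := Set.not_subset.1 h1
          exact ⟨v, fun _ => ⟨hv, not_le.1 hv0⟩⟩
        · exact ⟨0, fun h => absurd h hi⟩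
      choose v hv using hneg
      have hmem := (hconv _ (hcB l hl)).sum_mem s (p := fun i => ((i : Y) : X)) (l := l) (u := v)
        (fun i _ => hYB (i : Y).2) (fun i _ => hl.1 i) hs1 (hsc ▸ hcB l hl)
        (fun i hi => (hv i hi).1)
      rw [hsc] at hmem
      have hsne : s.Nonempty := Finset.nonempty_of_sum_ne_zero (hs1 ▸ one_ne_zero)
      have hlt : ∑ i ∈ s, l i * v i < 0 := Finset.sum_neg (fun i hi =>
        mul_neg_of_pos_of_neg (by simpa [s] using hi) (hv i hi).2) hsne
      exact absurd (hdiag _ (hcB l hl) hmem) (not_le.2 hlt))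
  exact ⟨toWeakSpace ℝ X (c l), Set.mem_image_of_mem _ (hcB l hl),
    Set.mem_iInter₂.2 fun y hy => hlC ⟨y, hy⟩⟩

/-- A dense subset of a convex set meeting an open ball stays dense after intersecting both sets
with the closed ball. -/
theorem Convex.inter_closedBall_subset_closure {X : Type*} [NormedAddCommGroup X]
    [NormedSpace ℝ X] {K D : Set X} (hK : Convex ℝ K) (hD : K ⊆ closure D) {R : ℝ} {a : X}
    (ha : a ∈ K) (haR : ‖a‖ < R) :
    K ∩ Metric.closedBall 0 R ⊆ closure (D ∩ Metric.closedBall 0 R) := by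
  rintro y ⟨hy, hyR⟩
  have hopen : K ∩ Metric.ball 0 R ⊆ closure (D ∩ Metric.closedBall 0 R) := fun z hz =>
    closure_mono (Set.inter_subset_inter_right _ Metric.ball_subset_closedBall)
      (Metric.isOpen_ball.closure_inter ⟨hD hz.1, hz.2⟩)
  -- Moving from `y` towards `a` enters the open ball, even when `y` is on the sphere.
  have hseg : openSegment ℝ a y ⊆ K ∩ Metric.ball 0 R := by
    rintro _ ⟨s, t, hs, ht, hst, rfl⟩
    refine ⟨hK ha hy hs.le ht.le hst, ?_⟩
    have hyR' : ‖y‖ ≤ R := by simpa using hyR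
    have h1 : ‖s • a + t • y‖ ≤ s * ‖a‖ + t * ‖y‖ := by
      simpa [norm_smul, abs_of_pos hs, abs_of_pos ht] using norm_add_le (s • a) (t • y)
    have h2 : s * ‖a‖ < s * R := mul_lt_mul_of_pos_left haR hs
    have h3 : t * ‖y‖ ≤ t * R := mul_le_mul_of_nonneg_left hyR' ht.le
    have h4 : s * R + t * R = R := by rw [← add_mul, hst, one_mul]
    simpa using by linarith
  have hy' : y ∈ closure (openSegment ℝ a y) := by
    rw [closure_openSegment]
    exact right_mem_segment ℝ a y
  exact closure_minimal (hseg.trans hopen) isClosed_closure hy'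

/-- Nonnegativity on `K ∩ closedBall 0 R` propagates to `K` if the value at some point of the open
ball contains a nonpositive number. -/
theorem SetValuedConvexOn.subset_Ici_of_inter_closedBall {X : Type*} [NormedAddCommGroup X]
    [NormedSpace ℝ X] {K : Set X} (hK : Convex ℝ K) {T : X → Set ℝ} (hT : SetValuedConvexOn T K)
    {R : ℝ} (hpos : ∀ y ∈ K ∩ Metric.closedBall 0 R, T y ⊆ Set.Ici 0) {a : X} (ha : a ∈ K)
    (haR : ‖a‖ < R) {v : ℝ} (hv : v ∈ T a) (hv0 : v ≤ 0) : ∀ y ∈ K, T y ⊆ Set.Ici 0 := by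
  intro y hy u hu
  by_contra hneg
  have hneg : u < 0 := not_le.1 hneg
  obtain ⟨t, ht0, ht1, htR⟩ : ∃ t : ℝ, 0 < t ∧ t ≤ 1 ∧ (1 - t) • a + t • y ∈
      Metric.closedBall (0 : X) R := by
    have hcont : Continuous fun t : ℝ => (1 - t) • a + t • y := by fun_prop
    have h0 : ∀ᶠ t in nhds (0 : ℝ), (1 - t) • a + t • y ∈ Metric.ball (0 : X) R :=
      hcont.continuousAt.eventually_mem (Metric.isOpen_ball.mem_nhds (by simpa using haR))
    obtain ⟨ε, hε, hball⟩ := Metric.eventually_nhds_iff.1 h0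
    refine ⟨min 1 (ε / 2), by positivity, min_le_left _ _,
      Metric.ball_subset_closedBall (hball ?_)⟩
    have h1 : 0 < min 1 (ε / 2) := by positivity
    rw [Real.dist_eq, sub_zero, abs_of_pos h1]
    linarith [min_le_right 1 (ε / 2)]
  have hmem := hT.add_mem hK ha hy (sub_nonneg.2 ht1) ht0.le (by ring) hv hu
  have h0 := hpos _ ⟨hK ha hy (sub_nonneg.2 ht1) ht0.le (by ring), htR⟩ hmem
  have h1 : (1 - t) * v ≤ 0 := mul_nonpos_of_nonneg_of_nonpos (sub_nonneg.2 ht1) hv0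
  have h2 : t * u < 0 := mul_neg_of_pos_of_neg ht0 hneg
  exact absurd (Set.mem_Ici.1 h0) (not_le.2 (add_neg_of_nonpos_of_neg h1 h2))

theorem theorem4p4 {X : Type*} [NormedAddCommGroup X] [NormedSpace ℝ X] [CompleteSpace X]
    (hX : IsReflexiveSpace X)
    (K D : Set X) (hKne : K.Nonempty) (hKconv : Convex ℝ K) (hKclosed : IsClosed K)
    (hD : IsSelfSegmentDense (weakSet D) (weakSet K))
    (F : X → X → Set ℝ)
    (h1 : ∀ y ∈ D, ∀ x ∈ K, WeakLscWithinAt (fun z => F z y) K x)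
    (h2 : ∀ x ∈ K, ∀ y ∈ K \ D, WeakLscWithinAt (fun z => F x z) K y)
    (h3 : ∀ x ∈ K, SetValuedConvexOn (fun y => F x y) K)
    (h4 : ∀ x ∈ K, (∀ u ∈ F x x, 0 ≤ u) ∧ (0 : ℝ) ∈ F x x)
    (h5 : ∃ r : ℝ, 0 < r ∧ ∀ x ∈ K, r < ‖x‖ →
      ∃ y₀ ∈ K, ‖y₀‖ < ‖x‖ ∧ (F x y₀ ∩ Set.Iic 0).Nonempty) :
    ∃ x₀ ∈ K, ∀ y ∈ K, ∀ u ∈ F x₀ y, 0 ≤ u := by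
  obtain ⟨r, -, hr⟩ := h5
  obtain ⟨a, ha⟩ := hKne
  -- `R > r` makes (v) available on the sphere of radius `R`; `R > ‖a‖` puts a point of `K` in the
  -- open ball.
  set R := max r ‖a‖ + 1 with hR
  have hrR : r < R := (le_max_left _ _).trans_lt (lt_add_one _)
  have haR : ‖a‖ < R := (le_max_right _ _).trans_lt (lt_add_one _)
  set B := K ∩ Metric.closedBall (0 : X) R with hB
  have hBK : B ⊆ K := Set.inter_subset_left
  have hBconv : Convex ℝ B := hKconv.inter (convex_closedBall 0 R)
  have hBcl : IsClosed B := hKclosed.inter Metric.isClosed_closedBall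
  have hDK : D ⊆ K := (Set.image_subset_image_iff (toWeakSpace ℝ X).injective).1 hD.subset
  have hDB : D ∩ Metric.closedBall 0 R ⊆ B := Set.inter_subset_inter_left _ hDK
  have hdiag : ∀ x ∈ K, F x x ⊆ Set.Ici 0 := fun x hx => (h4 x hx).1
  obtain ⟨x, hxB, hx⟩ := exists_forall_subset_Ici_of_isCompact_weakSet
    (B := B) (Y := D ∩ Metric.closedBall 0 R) (F := F) ⟨a, ha, by simpa using haR.le⟩ hBconv
    (isCompact_weakSet hX hBconv hBcl (Metric.isBounded_closedBall.subset Set.inter_subset_right))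
    (isClosed_weakSet hBconv hBcl) hDB
    (fun y hy z hz => (h1 y hy.1 z (hBK hz)).mono hBK)
    (fun z hz n p l hp hl hl1 hs => h3 z (hBK hz) n p l (fun i => hBK (hp i)) hl hl1 (hBK hs))
    (fun z hz => hdiag z (hBK hz))
  have hxK : x ∈ K := hBK hxB
  have hpos : ∀ y ∈ B, F x y ⊆ Set.Ici 0 := by
    intro y hy
    by_cases hyD : y ∈ D
    · exact hx y ⟨hyD, hy.2⟩
    · exact (h2 x hxK y ⟨hy.1, hyD⟩).subset_of_mem_closure isClosed_Ici (hDB.trans hBK)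
        (hKconv.inter_closedBall_subset_closure hD.subset_closure_of_weakSet ha haR hy) hx
  -- If `‖x‖ < R`, then `b = x` works since `0 ∈ F x x`; on the sphere, (v) supplies `b`.
  obtain ⟨b, hb, hbR, v, hv, hv0⟩ : ∃ b ∈ K, ‖b‖ < R ∧ (F x b ∩ Set.Iic 0).Nonempty := by
    have hxR : ‖x‖ ≤ R := by simpa using hxB.2
    rcases hxR.lt_or_eq with hlt | heq
    · exact ⟨x, hxK, hlt, 0, (h4 x hxK).2, Set.self_mem_Iic⟩
    · obtain ⟨y, hy, hyx, hne⟩ := hr x hxK (heq ▸ hrR)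
      exact ⟨y, hy, heq ▸ hyx, hne⟩
  exact ⟨x, hxK, (h3 x hxK).subset_Ici_of_inter_closedBall hKconv hpos hb hbR hv hv0⟩
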